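/- **Model.** In the (deterministic) CONGEST model, the communication network is a finite simple graph $G=(V,E)$ on $n$ nodes with maximum degree at most $\Delta$. Every node has a unique $O(\log n)$-bit identifier; at the start it knows $n$, $\Delta$, its own identifier and its degree, and it distinguishes its incident edges by an arbitrary port numbering. Time proceeds in synchronous rounds; in each round every node may send a (possibly different) message of $O(\log n)$ bits to each of its neighbors and perform unbounded deterministic local computation. The nodes terminate with an output saying whether they belong to the computed set, and the time complexity is the number of rounds until all nodes have terminated. A $(2,\beta)$-ruling set of $G$ is a set $R\subseteq V$ such that any two distinct nodes of $R$ are at distance at least $2$ in $G$ and every $v\in V$ has some $u\in R$ with $\mathrm{dist}_G(v,u)\le\beta$. Here $\log^* n$ is the number of times $\log_2$ has to be applied to $n$ until the result is at most $1$. **Corollary.** Let $\beta>2$ be an integer. There exists a deterministic distributed algorithm that computes a $(2,\beta)$-ruling set of $G$ in $$O\bigl(\beta\cdot\Delta^{2/\beta}+\log^* n\bigr)$$ rounds in the CONGEST model. The constants hidden in the round bound and in the message size depend only on the constant in the $O(\log n)$ bound on the length of the identifiers; in particular they do not depend on $\beta$, $\Delta$, $n$ or $G$. -/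

import Mathlib

/-- An `(α, β)`-ruling set: distinct members are at distance at least `α`, and every vertex has a
member within distance `β`. Distances are extended (`⊤` between different components). -/
def IsRulingSet {V : Type*} (G : SimpleGraph V) (α β : ℕ) (R : Set V) : Prop :=
  (∀ u ∈ R, ∀ v ∈ R, u ≠ v → (α : ℕ∞) ≤ G.edist u v) ∧
    ∀ v : V, ∃ u ∈ R, G.edist v u ≤ (β : ℕ∞)

/-- The iterated logarithm `log* n`: how often `log₂` has to be applied to `n` until the result
is at most `1`. -/
noncomputable def logStar (n : ℕ) : ℕ :=
  sInf {k : ℕ | (Real.logb 2)^[k] (n : ℝ) ≤ 1}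

/-- The data that turns a finite graph into a communication network: unique identifiers, and at
every node an (arbitrary) numbering of the incident edges by ports. -/
structure Network {V : Type*} [Fintype V] (G : SimpleGraph V) [DecidableRel G.Adj] where
  id : V → ℕ
  id_injective : Function.Injective id
  port : (v : V) → Fin (G.degree v) ≃ G.neighborSet v

/-- A deterministic synchronous message passing algorithm, executed by every node. Messages are
bit strings. Local computation is unrestricted. -/
structure DistributedAlgorithm where
  /-- The local states of a node. -/
  State : Type
  /-- The initial state of a node, from the number `n` of nodes, the degree bound `Δ`, the
  identifier of the node and its degree. -/
  init : (n Δ ident deg : ℕ) → State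
  /-- The message that a node in a given state sends through a given port. -/
  send : State → (port : ℕ) → List Bool
  /-- The new state, from the old one and the messages received, listed by port number. -/
  step : State → List (List Bool) → State
  /-- `some b` if the node has terminated with output `b`, and `none` while it is running. -/
  output : State → Option Bool

namespace DistributedAlgorithm

variable (A : DistributedAlgorithm)

/-- The message actually put on a port. A node that has terminated sends nothing. -/
def outgoing (s : A.State) (p : ℕ) : List Bool :=
  if (A.output s).isSome then [] else A.send s p

variable {V : Type*} [Fintype V] {G : SimpleGraph V} [DecidableRel G.Adj] (N : Network G)

/-- The messages that node `v` receives in one round in which the nodes are in the states `c`: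
through port `p` it gets what the neighbor `w` behind `p` sends on the edge from `w` to `v`. -/
def inbox (c : V → A.State) (v : V) : List (List Bool) :=
  List.ofFn fun p : Fin (G.degree v) =>
    A.outgoing (c (N.port v p))
      ((N.port (N.port v p)).symm ⟨v, G.adj_symm (N.port v p).2⟩ : Fin _)

/-- One synchronous round. Nodes that have terminated do not change any more. -/
def round (c : V → A.State) (v : V) : A.State :=
  if (A.output (c v)).isSome then c v else A.step (c v) (A.inbox N c v)

/-- The states of all nodes after `t` rounds, where `Δ` is the degree bound told to the nodes. -/
def config (Δ : ℕ) : ℕ → V → A.State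
  | 0 => fun v => A.init (Fintype.card V) Δ (N.id v) (G.degree v)
  | t + 1 => A.round N (config Δ t)

/-- In every round, every message sent over an edge has at most `b` bits. -/
def MessagesAtMost (Δ b : ℕ) : Prop :=
  ∀ (t : ℕ) (v : V) (p : Fin (G.degree v)), (A.outgoing (A.config N Δ t v) p).length ≤ b

/-- After `T` rounds, all nodes have terminated. -/
def TerminatesWithin (Δ T : ℕ) : Prop :=
  ∀ v : V, (A.output (A.config N Δ T v)).isSome

/-- The set of nodes that have terminated with output `true` within `T` rounds. -/
def outputSet (Δ T : ℕ) : Set V :=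
  {v | A.output (A.config N Δ T v) = some true}

end DistributedAlgorithm

/-!
The algorithm first computes a proper coloring with `O(Δ ^ 2)` colors and then sweeps through the
`β` digits of the colors, written in base `B = O(Δ ^ (2 / β))`.

*Coloring.* Linial's color reduction encodes colors as polynomials of degree at most `d` over
`ZMod q`. Two of them agree in at most `d` points, so if `q > Δ * d`, every node finds a point at
which its polynomial differs from those of all its neighbors, and the pair of this point and the
value there is a new color out of `q ^ 2` (`exists_colorReduction`). With `d = L`, this
leads from `2 ^ L` colors to `O((Δ * L) ^ 2)`. Starting from the identifiers, `3 * logStar n` such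
steps make the number of bits linear in the number of bits of `Δ`
(`iterate_logStar_bitsAfterStep_le`), one more step makes the number of colors `O(Δ ^ 4)`, and a
step with `d = 3` makes it `O(Δ ^ 2)`.

*Elimination.* All nodes start alive. Digits are processed from the lowest one. Phase `i` has one
round for each value `j < B` of the digit `i`. In this round, an alive node whose digit `i` is `j`
dies if it has an alive neighbor with a smaller digit `i` and the same higher digits. After phase
`i`, adjacent alive nodes differ in a higher digit (`Survives.div_pow_ne`), so after all `β` phases
the alive nodes are independent. The neighbor that kills a node survives the phase, so each phase
increases the distance to the nearest alive node by at most one (`Survives.exists_edist_le`). The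
nodes that stay alive form a `(2, β)`-ruling set (`isRulingSet_survives`), after `β * B` rounds.

All messages consist of a color and one more bit, and the colors never get longer than `O(log n)`
bits (`rulingSetAlgorithm.size_color_le`).
-/

/-! ### One step of color reduction -/

/-- Polynomials of degree at most `d` over `ZMod q` can encode `(N + 1) ^ (d + 1)` colors. -/
theorem exists_injOn_polynomial {q : ℕ} [NeZero q] {d N : ℕ} (hN : N < q) :
    ∃ P : ℕ → Polynomial (ZMod q),
      (∀ c, (P c).natDegree ≤ d) ∧ Set.InjOn P (Set.Iio ((N + 1) ^ (d + 1))) := by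
  have hcard : Fintype.card (Fin ((N + 1) ^ (d + 1))) ≤
      Fintype.card (Fin (d + 1) → ZMod q) := by
    simp only [Fintype.card_fin, Fintype.card_pi_const, ZMod.card]
    exact Nat.pow_le_pow_left hN _
  obtain ⟨φ⟩ := Function.Embedding.nonempty_of_card_le hcard
  let ψ := (Polynomial.degreeLTEquiv (ZMod q) (d + 1)).symm
  refine ⟨fun c => if h : c < (N + 1) ^ (d + 1) then (ψ (φ ⟨c, h⟩) : Polynomial (ZMod q)) else 0,
    fun c => ?_, fun c hc c' hc' h => ?_⟩
  · dsimp only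
    split_ifs with h
    · have := (ψ (φ ⟨c, h⟩)).2
      rw [Polynomial.mem_degreeLT] at this
      rcases eq_or_ne (ψ (φ ⟨c, h⟩) : Polynomial (ZMod q)) 0 with h0 | h0
      · simp [h0]
      · exact Nat.lt_succ_iff.1 ((Polynomial.natDegree_lt_iff_degree_lt h0).2 this)
    · simp
  · simp only [Set.mem_Iio] at hc hc'
    simp only [hc, hc', dif_pos] at h
    simpa using φ.injective (ψ.injective (Subtype.ext h))

/-- Linial's color reduction. A node of color `c < (N + 1) ^ (d + 1)` whose at most `Δ` neighbors
have the colors in `S` can choose a new color `f c S < 4 * N ^ 2`. The new color is a point of the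
graph of the polynomial encoding `c` which avoids the graphs of the polynomials of the neighbors;
whichever point `(e', p' e')` a neighbor chooses on its own graph, it is a different one. -/
theorem exists_colorReduction (Δ d N : ℕ) :
    ∃ f : ℕ → Set ℕ → ℕ, N ≠ 0 → Δ * d ≤ N →
      (∀ c S, f c S < 4 * N ^ 2) ∧
      ∀ c < (N + 1) ^ (d + 1), ∀ S : Finset ℕ, S.card ≤ Δ →
        (∀ c' ∈ S, c' < (N + 1) ^ (d + 1)) → c ∉ S → ∀ c' ∈ S, ∀ S' : Set ℕ,
          f c S ≠ f c' S' := by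
  rcases eq_or_ne N 0 with hN | hN
  · exact ⟨fun _ _ => 0, fun h => absurd hN h⟩
  obtain ⟨q, hq, hNq, hqN⟩ := Nat.exists_prime_lt_and_le_two_mul N hN
  have : Fact q.Prime := ⟨hq⟩
  obtain ⟨P, hdeg, hinj⟩ := exists_injOn_polynomial (d := d) hNq
  classical
  let e : ℕ → Set ℕ → ZMod q := fun c S =>
    if h : ∃ x : ZMod q, ∀ y ∈ S, (P c).eval x ≠ (P y).eval x then h.choose else 0
  have hval : ∀ x y x' y' : ZMod q, q * x.val + y.val = q * x'.val + y'.val → x = x' ∧ y = y' := by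
    intro x y x' y' h
    have hy : y.val = y'.val := by
      have := congrArg (· % q) h
      simpa [Nat.mul_add_mod, Nat.mod_eq_of_lt (ZMod.val_lt _)] using this
    have hx : x.val = x'.val := by
      rw [hy] at h
      exact Nat.eq_of_mul_eq_mul_left hq.pos (by omega)
    exact ⟨ZMod.val_injective q hx, ZMod.val_injective q hy⟩
  refine ⟨fun c S => q * (e c S).val + ((P c).eval (e c S)).val, fun _ hd => ⟨fun c S => ?_, ?_⟩⟩
  · have h1 := ZMod.val_lt (e c S)
    have h2 := ZMod.val_lt ((P c).eval (e c S))
    calc q * (e c S).val + ((P c).eval (e c S)).val < q * ((e c S).val + 1) := by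
          rw [mul_add]; omega
      _ ≤ q * q := Nat.mul_le_mul_left _ h1
      _ ≤ (2 * N) * (2 * N) := Nat.mul_le_mul hqN hqN
      _ = 4 * N ^ 2 := by ring
  · intro c hc S hS hSm hcS c' hc' S' heq
    obtain ⟨h1, h2⟩ := hval _ _ _ _ heq
    rw [← h1] at h2
    -- Each neighbor rules out at most `d` of the `q > Δ * d` points.
    have hgood : ∃ x : ZMod q, ∀ y ∈ (S : Set ℕ), (P c).eval x ≠ (P y).eval x := by
      have hlt : (S.biUnion fun y => (P c - P y).roots.toFinset).card <
          (Finset.univ : Finset (ZMod q)).card := by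
        calc _ ≤ S.card * d := Finset.card_biUnion_le_card_mul _ _ _ fun y _ =>
              (Multiset.toFinset_card_le _).trans ((Polynomial.card_roots' _).trans
                ((Polynomial.natDegree_sub_le _ _).trans (max_le (hdeg c) (hdeg y))))
          _ ≤ Δ * d := Nat.mul_le_mul_right _ hS
          _ < q := hd.trans_lt hNq
          _ = _ := by simp [ZMod.card]
      obtain ⟨x, -, hx⟩ := Finset.exists_mem_notMem_of_card_lt_card hlt
      refine ⟨x, fun y hy hxy => hx ?_⟩
      have hne : P c - P y ≠ 0 := sub_ne_zero.2 fun h =>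
        hcS (hinj hc (hSm y hy) h ▸ hy)
      simp only [Finset.mem_biUnion, Multiset.mem_toFinset]
      exact ⟨y, hy, by simp [hne, hxy]⟩
    have he : e c S = hgood.choose := dif_pos hgood
    rw [he] at h2
    exact hgood.choose_spec c' hc' h2

/-- The map of `exists_colorReduction`. -/
noncomputable def colorReduction (Δ d N : ℕ) : ℕ → Set ℕ → ℕ :=
  (exists_colorReduction Δ d N).choose

theorem colorReduction_lt {Δ d N : ℕ} (hN : N ≠ 0) (hd : Δ * d ≤ N) (c : ℕ) (S : Set ℕ) :
    colorReduction Δ d N c S < 4 * N ^ 2 :=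
  ((exists_colorReduction Δ d N).choose_spec hN hd).1 c S

/-- The reduced coloring of a properly colored graph is proper. -/
theorem colorReduction_ne {V : Type*} [Fintype V] {G : SimpleGraph V} [DecidableRel G.Adj]
    {Δ d N : ℕ} (hN : N ≠ 0) (hd : Δ * d ≤ N) (hG : ∀ v, G.degree v ≤ Δ) {c : V → ℕ}
    (hc : ∀ v, c v < (N + 1) ^ (d + 1)) (hproper : ∀ u v, G.Adj u v → c u ≠ c v)
    {u v : V} (huv : G.Adj u v) :
    colorReduction Δ d N (c u) (c '' G.neighborSet u) ≠
      colorReduction Δ d N (c v) (c '' G.neighborSet v) := by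
  classical
  have hS : ((G.neighborFinset u).image c : Set ℕ) = c '' G.neighborSet u := by simp
  rw [← hS]
  refine ((exists_colorReduction Δ d N).choose_spec hN hd).2 (c u) (hc u) _
    (Finset.card_image_le.trans (hG u)) ?_ ?_ (c v) ?_ _
  · simp only [Finset.mem_image]
    rintro _ ⟨w, -, rfl⟩
    exact hc w
  · simp only [Finset.mem_image, SimpleGraph.mem_neighborFinset, not_exists, not_and]
    exact fun w hw h => hproper u w hw h.symm
  · exact Finset.mem_image_of_mem c ((G.mem_neighborFinset u v).2 huv)

/-! ### The number of color reduction steps -/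

theorem Nat.size_mul_le (m n : ℕ) : (m * n).size ≤ m.size + n.size := by
  rw [Nat.size_le, pow_add]
  exact Nat.mul_lt_mul'' m.lt_size_self n.lt_size_self

theorem Nat.size_le_self (n : ℕ) : n.size ≤ n :=
  Nat.size_le.2 n.lt_two_pow_self

theorem Nat.two_pow_size_le {n : ℕ} (hn : n ≠ 0) : 2 ^ n.size ≤ 2 * n := by
  have hpos := Nat.size_pos.2 (Nat.pos_of_ne_zero hn)
  have h : 2 ^ (n.size - 1) ≤ n := Nat.lt_size.1 (by omega)
  have h2 : n.size = (n.size - 1) + 1 := by omega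
  rw [h2, pow_succ]
  omega

theorem Nat.four_mul_size_le {n : ℕ} (hn : 64 ≤ n) : 4 * n.size ≤ n := by
  have key : ∀ r, 7 ≤ r → 4 * r ≤ 2 ^ (r - 1) := by
    intro r hr
    induction r, hr using Nat.le_induction with
    | base => norm_num
    | succ r hr ih =>
      obtain ⟨k, rfl⟩ := Nat.exists_eq_add_of_le' (show 1 ≤ r by omega)
      simp only [Nat.add_sub_cancel] at ih ⊢
      rw [pow_succ]; omega
  have h7 : 7 ≤ n.size := Nat.lt_size.2 (by simpa using hn)
  exact (key _ h7).trans (Nat.lt_size.1 (by omega))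

theorem Nat.sq_size_le {n : ℕ} : n.size ^ 2 ≤ max 64 n := by
  rcases le_or_gt n.size 8 with h | h
  · exact le_max_of_le_left (by nlinarith)
  · have key : ∀ r, 7 ≤ r → r ^ 2 ≤ 2 ^ (r - 1) := by
      intro r hr
      induction r, hr using Nat.le_induction with
      | base => norm_num
      | succ r hr ih =>
        obtain ⟨k, rfl⟩ := Nat.exists_eq_add_of_le' (show 1 ≤ r by omega)
        simp only [Nat.add_sub_cancel] at ih ⊢
        rw [pow_succ 2]; nlinarith
    exact le_max_of_le_right ((key _ (by omega)).trans (Nat.lt_size.1 (by omega)))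

/-- If `b` bits suffice to write down the current colors, then `bitsAfterStep D b` bits suffice
after one step of color reduction in a graph whose degrees have at most `D` bits. -/
def bitsAfterStep (D b : ℕ) : ℕ := 2 * (D + b.size + 1)

theorem bitsAfterStep_le {D K r b : ℕ} (hK : 64 ≤ K) (hD : D ≤ r) (hr : 1 ≤ r) (hb : b ≤ K * r) :
    bitsAfterStep D b ≤ K * r := by
  have h1 : b.size ≤ K.size + r :=
    (Nat.size_le_size hb).trans ((Nat.size_mul_le K r).trans (by gcongr; exact r.size_le_self))
  have h2 := Nat.four_mul_size_le hK
  unfold bitsAfterStep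
  nlinarith

theorem iterate_bitsAfterStep_le {D K r b : ℕ} (hK : 64 ≤ K) (hD : D ≤ r) (hr : 1 ≤ r)
    (hb : b ≤ K * r) (t : ℕ) : (bitsAfterStep D)^[t] b ≤ K * r := by
  induction t with
  | zero => exact hb
  | succ t ih =>
    rw [Function.iterate_succ_apply']
    exact bitsAfterStep_le hK hD hr ih

/-- As long as the degrees are negligible, the number of bits shrinks logarithmically. -/
theorem iterate_bitsAfterStep_le_or {D K : ℕ} (hK : 64 ≤ K) (hD : 1 ≤ D) (b t : ℕ) :
    (bitsAfterStep D)^[t] b ≤ K * D ∨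
      (bitsAfterStep D)^[t] b ≤ (fun x : ℕ => 6 * x.size)^[t] b := by
  induction t with
  | zero => exact Or.inr le_rfl
  | succ t ih =>
    simp only [Function.iterate_succ_apply']
    rcases ih with ih | ih
    · exact Or.inl (bitsAfterStep_le hK le_rfl hD ih)
    · have hs := Nat.size_le_size ih
      generalize (bitsAfterStep D)^[t] b = x at hs ⊢
      rcases le_total x.size D with h | h
      · left; unfold bitsAfterStep; nlinarith
      · right; unfold bitsAfterStep; omega

/-- Three steps of `x ↦ 6 * x.size` do at least as well as one binary logarithm. -/
theorem iterate_three_size_le (x : ℕ) :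
    (((fun x : ℕ => 6 * x.size)^[3] x : ℕ) : ℝ) ≤ max 64 (Real.logb 2 x) := by
  rcases eq_or_ne x 0 with rfl | hx
  · simp
  have hlog : ((x.size - 1 : ℕ) : ℝ) ≤ Real.logb 2 x := by
    rw [Real.le_logb_iff_rpow_le (by norm_num) (by positivity), Real.rpow_natCast]
    have := Nat.size_pos.2 (Nat.pos_of_ne_zero hx)
    exact_mod_cast Nat.lt_size.1 (by omega)
  have key : (fun x : ℕ => 6 * x.size)^[3] x ≤ max 64 (x.size - 1) := by
    simp only [Function.iterate_succ_apply', Function.iterate_zero, id]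
    generalize x.size = s
    rcases le_or_gt s.size 9 with h | h
    · have h0 : s < 2 ^ 9 := Nat.size_le.1 h
      have h1 : (6 * s).size ≤ 12 := Nat.size_le.2 (by omega)
      have h2 : (6 * (6 * s).size).size ≤ 7 := Nat.size_le.2 (by omega)
      omega
    · have h6 : Nat.size 6 ≤ 3 := Nat.size_le.2 (by norm_num)
      have h1 := Nat.size_mul_le 6 s
      have h2 := Nat.size_mul_le 6 (6 * s).size
      have h3 := (6 * s).size.size_le_self
      have h4 : s.size ^ 2 ≤ s := by
        rcases le_max_iff.1 (Nat.sq_size_le (n := s)) with h | h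
        · nlinarith
        · exact h
      have h5 : 6 * s.size + 37 ≤ s.size ^ 2 := by nlinarith
      omega
  calc _ ≤ ((max 64 (x.size - 1) : ℕ) : ℝ) := by exact_mod_cast key
    _ ≤ _ := by
      rw [Nat.cast_max]
      exact max_le_max (by norm_num) hlog

/-- The iterates of `x ↦ 6 * x.size`, taken three at a time, follow those of the binary logarithm
until they fall below a constant. -/
theorem iterate_size_le {K : ℕ} (hK : 64 ≤ K) (k : ℕ) {x : ℕ} {y : ℝ}
    (hxy : (x : ℝ) ≤ max (K : ℝ) y) :
    (((fun x : ℕ => 6 * x.size)^[3 * k] x : ℕ) : ℝ) ≤ max (K : ℝ) ((Real.logb 2)^[k] y) := by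
  induction k with
  | zero => simpa using hxy
  | succ k ih =>
    rw [mul_add, mul_one, add_comm, Function.iterate_add_apply,
      Function.iterate_succ_apply' (Real.logb 2)]
    generalize (fun x : ℕ => 6 * x.size)^[3 * k] x = z at ih
    generalize (Real.logb 2)^[k] y = w at ih
    have hK' : (64 : ℝ) ≤ K := by exact_mod_cast hK
    rcases le_or_gt z K with hz | hz
    · refine le_max_of_le_left ?_
      have hstep : ∀ u : ℕ, u ≤ K → 6 * u.size ≤ K := by
        intro u hu
        rcases le_or_gt u 64 with h | h
        · have : u.size ≤ 7 := Nat.size_le.2 (by omega)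
          omega
        · have h1 := Nat.sq_size_le (n := u)
          have h2 : 7 ≤ u.size := Nat.lt_size.2 (by omega)
          rw [max_eq_right h.le] at h1
          nlinarith
      simp only [Function.iterate_succ_apply', Function.iterate_zero, id]
      exact_mod_cast hstep _ (hstep _ (hstep _ hz))
    · have hz' : (K : ℝ) < z := by exact_mod_cast hz
      have hzw : (z : ℝ) ≤ w := (le_max_iff.1 ih).resolve_left (not_le.2 hz')
      exact (iterate_three_size_le z).trans
        (max_le_max hK' (Real.logb_le_logb_of_le (one_lt_two (α := ℝ)) (by linarith) hzw))

theorem exists_iterate_logb_le_one (n : ℕ) :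
    ∀ x : ℝ, 0 ≤ x → x ≤ n + 1 → ∃ k, (Real.logb 2)^[k] x ≤ 1 := by
  induction n with
  | zero => exact fun x _ hx => ⟨0, by simpa using hx⟩
  | succ n ih =>
    intro x h0 hx
    rcases le_or_gt x 1 with h1 | h1
    · exact ⟨0, h1⟩
    · have hlog : Real.logb 2 x ≤ n + 1 := by
        rw [Real.logb_le_iff_le_rpow (by norm_num) (by linarith)]
        have := one_add_mul_self_le_rpow_one_add (s := 1) (by norm_num) (p := (n : ℝ) + 1)
          (by linarith [n.cast_nonneg (α := ℝ)])
        push_cast at hx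
        norm_num at this
        linarith
      obtain ⟨k, hk⟩ := ih _ (Real.logb_nonneg (by norm_num) h1.le) hlog
      exact ⟨k + 1, hk⟩

theorem iterate_logStar_le_one (n : ℕ) : (Real.logb 2)^[logStar n] (n : ℝ) ≤ 1 :=
  Nat.sInf_mem (s := {k : ℕ | (Real.logb 2)^[k] (n : ℝ) ≤ 1})
    (exists_iterate_logb_le_one n n n.cast_nonneg (by linarith))

/-- Starting from identifiers with `a * n.size` bits, `3 * logStar n` steps of color reduction
lead to colors with `O(D)` bits. -/
theorem iterate_logStar_bitsAfterStep_le (a n : ℕ) {D : ℕ} (hD : 1 ≤ D) :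
    (bitsAfterStep D)^[3 * logStar n] (a * n.size) ≤ (a ^ 2 + 64) * D := by
  rcases iterate_bitsAfterStep_le_or (Nat.le_add_left 64 (a ^ 2)) hD (a * n.size)
    (3 * logStar n) with h | h
  · exact h
  · have hx : ((a * n.size : ℕ) : ℝ) ≤ max ((a ^ 2 + 64 : ℕ) : ℝ) n := by
      have h1 : a * n.size ≤ max (a ^ 2) (n.size ^ 2) := by
        rcases le_total a n.size with h | h
        · exact le_max_of_le_right (by nlinarith)
        · exact le_max_of_le_left (by nlinarith)
      have h2 := Nat.sq_size_le (n := n)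
      have h3 : a * n.size ≤ max (a ^ 2 + 64) n := by omega
      exact_mod_cast h3
    have h4 := iterate_size_le (Nat.le_add_left 64 (a ^ 2)) (logStar n) hx
    have h5 : max ((a ^ 2 + 64 : ℕ) : ℝ) ((Real.logb 2)^[logStar n] (n : ℝ)) =
        ((a ^ 2 + 64 : ℕ) : ℝ) :=
      max_eq_left ((iterate_logStar_le_one n).trans (by exact_mod_cast (by omega)))
    rw [h5, Nat.cast_le] at h4
    exact h.trans (h4.trans (Nat.le_mul_of_pos_right _ hD))

/-! ### From a coloring to a ruling set -/

/-- In round `r = i * B + j` of the elimination, a node of color `c` beats a neighboring node of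
color `c'` if the base-`B` expansions of `c` and `c'` agree above the digit `i`, the digit `i` of
`c'` is `j`, and the digit `i` of `c` is smaller. -/
def Beats (B r c c' : ℕ) : Prop :=
  c' / B ^ (r / B) % B = r % B ∧ c / B ^ (r / B + 1) = c' / B ^ (r / B + 1) ∧
    c / B ^ (r / B) < c' / B ^ (r / B)

theorem beats_iff {B i j c c' : ℕ} (hj : j < B) :
    Beats B (i * B + j) c c' ↔
      c' / B ^ i % B = j ∧ c / B ^ (i + 1) = c' / B ^ (i + 1) ∧ c / B ^ i < c' / B ^ i := by
  have h1 : (i * B + j) / B = i := by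
    rw [add_comm, Nat.add_mul_div_right _ _ (by omega), Nat.div_eq_of_lt hj, zero_add]
  have h2 : (i * B + j) % B = j := by
    rw [add_comm, Nat.add_mul_mod_self_right, Nat.mod_eq_of_lt hj]
  rw [Beats, h1, h2]

/-- If two numbers agree above the digit `i`, comparing them from the digit `i` on amounts to
comparing this digit. -/
theorem div_pow_mod_lt_of_div_lt {B i x y : ℕ} (hxy : x / B ^ (i + 1) = y / B ^ (i + 1))
    (h : x / B ^ i < y / B ^ i) : x / B ^ i % B < y / B ^ i % B := by
  rw [pow_succ, ← Nat.div_div_eq_div_mul, ← Nat.div_div_eq_div_mul] at hxy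
  have h1 := Nat.div_add_mod (x / B ^ i) B
  have h2 := Nat.div_add_mod (y / B ^ i) B
  rw [hxy] at h1
  omega

/-- The nodes that survive the first `r` rounds of the elimination with colors `c`. In each round,
a surviving node is eliminated if a surviving neighbor beats it. -/
def Survives {V : Type*} (G : SimpleGraph V) (B : ℕ) (c : V → ℕ) : ℕ → V → Prop
  | 0, _ => True
  | r + 1, v => Survives G B c r v ∧
      ¬∃ u, G.Adj v u ∧ Survives G B c r u ∧ Beats B r (c u) (c v)

namespace Survives

variable {V : Type*} {G : SimpleGraph V} {B : ℕ} {c : V → ℕ}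

theorem mono {v : V} {r s : ℕ} (hrs : r ≤ s) (h : Survives G B c s v) : Survives G B c r v := by
  induction hrs with
  | refl => exact h
  | step _ ih => exact ih h.1

/-- A node can be eliminated only in the round of its digit. -/
theorem succ_of_ne {v : V} {i j : ℕ} (hj : j < B) (hne : c v / B ^ i % B ≠ j)
    (h : Survives G B c (i * B + j) v) : Survives G B c (i * B + j + 1) v :=
  ⟨h, fun ⟨_, _, _, hb⟩ => hne ((beats_iff hj).1 hb).1⟩

theorem until_digit {v : V} {i : ℕ} (h : Survives G B c (i * B) v) {j : ℕ} (hjB : j ≤ B)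
    (hj : j ≤ c v / B ^ i % B) : Survives G B c (i * B + j) v := by
  induction j with
  | zero => exact h
  | succ j ih => exact (ih (by omega) (by omega)).succ_of_ne (by omega) (by omega)

theorem of_survives_digit {v : V} {i : ℕ}
    (h : Survives G B c (i * B + (c v / B ^ i % B) + 1) v) :
    Survives G B c ((i + 1) * B) v := by
  have key : ∀ j ≤ B, Survives G B c (i * B + j) v := by
    intro j hj
    induction j with
    | zero => exact h.mono (by omega)
    | succ j ih =>
      rcases lt_or_ge (c v / B ^ i % B) j with hlt | hge
      · exact (ih (by omega)).succ_of_ne (by omega) hlt.ne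
      · exact h.mono (by omega)
  rw [add_mul, one_mul]
  exact key B le_rfl

/-- After `i` phases of `B` rounds, adjacent surviving nodes have colors that differ in or above
the digit `i`: of two adjacent nodes whose colors first differ in the digit `i - 1`, the one with
the smaller digit, if it survives the phase, eliminates the other one. -/
theorem div_pow_ne (hB : 0 < B) (hc : ∀ u v, G.Adj u v → c u ≠ c v) (i : ℕ) :
    ∀ u v, G.Adj u v → Survives G B c (i * B) u → Survives G B c (i * B) v →
      c u / B ^ i ≠ c v / B ^ i := by
  induction i with
  | zero => simpa using fun u v h _ _ => hc u v h
  | succ i ih =>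
    have key : ∀ u v, G.Adj u v → Survives G B c ((i + 1) * B) u →
        Survives G B c ((i + 1) * B) v →
        c u / B ^ (i + 1) = c v / B ^ (i + 1) → ¬c u / B ^ i < c v / B ^ i := by
      intro u v huv hu hv heq hlt
      have hmod : c v / B ^ i % B < B := Nat.mod_lt _ hB
      rw [add_mul, one_mul] at hu hv
      have hv' : Survives G B c (i * B + (c v / B ^ i % B) + 1) v := hv.mono (by omega)
      exact hv'.2 ⟨u, huv.symm, hu.mono (by omega), (beats_iff hmod).2 ⟨rfl, heq, hlt⟩⟩
    intro u v huv hu hv heq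
    have hne := ih u v huv (hu.mono (by nlinarith)) (hv.mono (by nlinarith))
    rcases lt_or_gt_of_ne hne with h | h
    · exact key u v huv hu hv heq h
    · exact key v u huv.symm hv hu heq.symm h

/-- After `i` phases of `B` rounds, every node has a surviving node within distance `i`: a node
that is eliminated in a phase is so by a neighbor with a smaller digit, which has passed the round
of its own digit and hence survives the phase. -/
theorem exists_edist_le (hB : 0 < B) (i : ℕ) (v : V) :
    ∃ u, Survives G B c (i * B) u ∧ G.edist v u ≤ i := by
  induction i with
  | zero => exact ⟨v, by simp [Survives], by simp⟩
  | succ i ih =>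
    obtain ⟨u, hu, hvu⟩ := ih
    have hmod : c u / B ^ i % B < B := Nat.mod_lt _ hB
    by_cases hs : Survives G B c (i * B + (c u / B ^ i % B) + 1) u
    · exact ⟨u, of_survives_digit hs, hvu.trans (by exact_mod_cast Nat.le_succ i)⟩
    · rw [Survives, not_and, not_not] at hs
      obtain ⟨w, huw, hw, hb⟩ := hs (until_digit hu hmod.le le_rfl)
      rw [beats_iff hmod] at hb
      have hlt := div_pow_mod_lt_of_div_lt hb.2.1 hb.2.2
      refine ⟨w, of_survives_digit (hw.mono (by omega)), ?_⟩
      calc G.edist v w ≤ G.edist v u + G.edist u w := SimpleGraph.edist_triangle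
        _ ≤ i + 1 := add_le_add hvu (SimpleGraph.edist_eq_one_iff_adj.2 huw).le
        _ = ((i + 1 : ℕ) : ℕ∞) := by push_cast; rfl

end Survives

/-- Eliminating along the `β` base-`B` digits of a proper coloring leaves a `(2, β)`-ruling set. -/
theorem isRulingSet_survives {V : Type*} {G : SimpleGraph V} {B β : ℕ} {c : V → ℕ} (hB : 0 < B)
    (hc : ∀ u v, G.Adj u v → c u ≠ c v) (hcB : ∀ v, c v < B ^ β) :
    IsRulingSet G 2 β {v | Survives G B c (β * B) v} := by
  refine ⟨fun u hu v hv huv => ?_, fun v => Survives.exists_edist_le hB β v⟩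
  have hadj : ¬G.Adj u v := fun h => Survives.div_pow_ne hB hc β u v h hu hv (by
    rw [Nat.div_eq_of_lt (hcB u), Nat.div_eq_of_lt (hcB v)])
  have h1 : G.edist u v ≠ 0 := fun h => huv (SimpleGraph.edist_eq_zero_iff.1 h)
  have h2 : G.edist u v ≠ 1 := fun h => hadj (SimpleGraph.edist_eq_one_iff_adj.1 h)
  have h3 := lt_of_le_of_ne (Order.one_le_iff_ne_zero.2 h1) h2.symm
  exact (by norm_num : ((2 : ℕ) : ℕ∞) = 1 + 1) ▸ Order.add_one_le_of_lt h3

/-! ### The algorithm -/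

theorem Nat.bits_injective : Function.Injective Nat.bits := by
  have h : ∀ n : ℕ, n.bits.foldr Nat.bit 0 = n := by
    intro n
    induction n using Nat.binaryRec' with
    | zero => simp
    | bit b n hn ih => rw [Nat.bits_append_bit _ _ hn, List.foldr_cons, ih]
  exact Function.LeftInverse.injective h

/-- The state of a node: the number `n` of nodes, the degree bound `Δ`, the number `time` of
rounds so far, the current color, and whether the node may still join the ruling set. -/
structure NodeState where
  n : ℕ
  Δ : ℕ
  time : ℕ
  color : ℕ
  alive : Bool

/-- The number of color reduction steps until the number of colors is polynomial in `Δ`. -/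
noncomputable def linialRounds (n : ℕ) : ℕ := 3 * logStar n + 1

/-- After `t` steps of color reduction, the colors have at most this number of bits. -/
def colorBits (a n Δ t : ℕ) : ℕ := (bitsAfterStep Δ.size)^[t] (a * n.size)

/-- The scale `N = O(Δ)` of the last color reduction, which leads to `4 * N ^ 2` colors. -/
def finalScale (a Δ : ℕ) : ℕ := 8 * (a ^ 2 + 64) * Δ

/-- The base in which the final colors have `β` digits. -/
noncomputable def digitBase (a β Δ : ℕ) : ℕ :=
  ⌈((4 * finalScale a Δ ^ 2 : ℕ) : ℝ) ^ ((1 : ℝ) / β)⌉₊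

/-- The total number of rounds. For `Δ = 0` no round may be used, since the time bound vanishes for
a single node; every node is then isolated. -/
noncomputable def runTime (a β n Δ : ℕ) : ℕ :=
  if Δ = 0 then 0 else linialRounds n + 1 + β * digitBase a β Δ

/-- The color of a node after round `t`, from its color and the colors of its neighbors. -/
noncomputable def nextColor (a n Δ t c : ℕ) (S : Set ℕ) : ℕ :=
  if t < linialRounds n then
    colorReduction Δ (colorBits a n Δ t) (Δ * colorBits a n Δ t) c S
  else if t = linialRounds n then colorReduction Δ 3 (finalScale a Δ) c S
  else c

open Classical in
/-- The ruling set algorithm for identifiers of at most `a * n.size` bits: Linial's color reduction,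
followed by the elimination along the `β` digits of the colors. In each round, every node
broadcasts its color, preceded by one bit that tells whether it is still alive. The degree bound is
replaced by `min Δ n`, which keeps the messages short if `Δ` is large. -/
noncomputable def rulingSetAlgorithm (a β : ℕ) : DistributedAlgorithm where
  State := NodeState
  init n Δ ident _ := ⟨n, min Δ n, 0, ident, true⟩
  send s _ := s.alive :: s.color.bits
  step s msgs :=
    { n := s.n
      Δ := s.Δ
      time := s.time + 1
      color := nextColor a s.n s.Δ s.time s.color {c | true :: c.bits ∈ msgs}
      alive := s.alive && decide (¬∃ c, true :: c.bits ∈ msgs ∧ linialRounds s.n + 1 ≤ s.time ∧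
        Beats (digitBase a β s.Δ) (s.time - (linialRounds s.n + 1)) c s.color) }
  output s := if runTime a β s.n s.Δ ≤ s.time then some s.alive else none

namespace rulingSetAlgorithm

/-! ### The execution of the algorithm -/

section Execution

variable {V : Type*} [Fintype V] {G : SimpleGraph V} [DecidableRel G.Adj] (N : Network G)
  (a β Δ : ℕ)

/-- The execution of the algorithm on the network `N`. -/
noncomputable abbrev exec : ℕ → V → NodeState := (rulingSetAlgorithm a β).config N Δ

/-- The degree bound that the nodes use. -/
abbrev degBound (V : Type*) [Fintype V] (Δ : ℕ) : ℕ := min Δ (Fintype.card V)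

/-- The round in which all nodes terminate. -/
noncomputable abbrev stopTime (V : Type*) [Fintype V] (a β Δ : ℕ) : ℕ :=
  runTime a β (Fintype.card V) (degBound V Δ)

theorem output_eq (s : NodeState) : (rulingSetAlgorithm a β).output s =
    if runTime a β s.n s.Δ ≤ s.time then some s.alive else none := rfl

variable {a β Δ} in
theorem exec_parameters {t : ℕ} (ht : t ≤ stopTime V a β Δ) (v : V) :
    (exec N a β Δ t v).n = Fintype.card V ∧ (exec N a β Δ t v).Δ = degBound V Δ ∧
      (exec N a β Δ t v).time = t := by
  induction t with
  | zero => exact ⟨rfl, rfl, rfl⟩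
  | succ t ih =>
    obtain ⟨h1, h2, h3⟩ := ih (by omega)
    have hout : ¬((rulingSetAlgorithm a β).output (exec N a β Δ t v)).isSome := by
      rw [output_eq, h1, h2, h3, if_neg (Nat.not_le_of_lt ht)]
      simp
    have hexec : exec N a β Δ (t + 1) v = (rulingSetAlgorithm a β).step (exec N a β Δ t v)
      ((rulingSetAlgorithm a β).inbox N (exec N a β Δ t) v) := if_neg hout
    rw [hexec]
    exact ⟨h1, h2, congrArg (· + 1) h3⟩

variable {a β Δ} in
theorem output_of_lt {t : ℕ} (ht : t < stopTime V a β Δ) (v : V) :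
    (rulingSetAlgorithm a β).output (exec N a β Δ t v) = none := by
  obtain ⟨h1, h2, h3⟩ := exec_parameters N ht.le v
  rw [output_eq, h1, h2, h3, if_neg (Nat.not_le_of_lt ht)]

theorem output_stopTime (v : V) :
    (rulingSetAlgorithm a β).output (exec N a β Δ (stopTime V a β Δ) v) =
      some (exec N a β Δ (stopTime V a β Δ) v).alive := by
  obtain ⟨h1, h2, h3⟩ := exec_parameters N (le_refl (stopTime V a β Δ)) v
  rw [output_eq, h1, h2, h3, if_pos le_rfl]

variable {a β Δ} in
theorem exec_of_le {t : ℕ} (ht : stopTime V a β Δ ≤ t) (v : V) :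
    exec N a β Δ t v = exec N a β Δ (stopTime V a β Δ) v := by
  induction t, ht using Nat.le_induction with
  | base => rfl
  | succ t _ ih =>
    have hout : ((rulingSetAlgorithm a β).output (exec N a β Δ t v)).isSome := by
      rw [ih, output_stopTime]; rfl
    exact (if_pos hout).trans ih

variable {a β Δ} in
/-- A node hears the colors of its alive neighbors. -/
theorem mem_inbox_iff {t : ℕ} (ht : t < stopTime V a β Δ) (v : V) (c : ℕ) :
    true :: c.bits ∈ (rulingSetAlgorithm a β).inbox N (exec N a β Δ t) v ↔
      ∃ u, G.Adj v u ∧ (exec N a β Δ t u).alive = true ∧ (exec N a β Δ t u).color = c := by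
  have hsend : ∀ u p, (rulingSetAlgorithm a β).outgoing (exec N a β Δ t u) p =
      (exec N a β Δ t u).alive :: (exec N a β Δ t u).color.bits := by
    intro u p
    rw [DistributedAlgorithm.outgoing, output_of_lt N ht u]
    rfl
  simp only [DistributedAlgorithm.inbox, List.mem_ofFn, hsend, List.cons.injEq,
    Nat.bits_injective.eq_iff]
  constructor
  · rintro ⟨p, h1, h2⟩
    exact ⟨N.port v p, (N.port v p).2, h1, h2⟩
  · rintro ⟨u, huv, h1, h2⟩
    refine ⟨(N.port v).symm ⟨u, huv⟩, ?_⟩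
    rw [Equiv.apply_symm_apply]
    exact ⟨h1, h2⟩

variable {a β Δ} in
theorem exec_succ {t : ℕ} (ht : t < stopTime V a β Δ) (v : V) :
    exec N a β Δ (t + 1) v = (rulingSetAlgorithm a β).step (exec N a β Δ t v)
      ((rulingSetAlgorithm a β).inbox N (exec N a β Δ t) v) :=
  if_neg (by rw [output_of_lt N ht v]; simp)

variable {a β Δ} in
theorem color_succ {t : ℕ} (ht : t < stopTime V a β Δ) (v : V) :
    (exec N a β Δ (t + 1) v).color =
      nextColor a (Fintype.card V) (degBound V Δ) t (exec N a β Δ t v).color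
        {c | ∃ u, G.Adj v u ∧ (exec N a β Δ t u).alive = true ∧
          (exec N a β Δ t u).color = c} := by
  obtain ⟨h1, h2, h3⟩ := exec_parameters N ht.le v
  rw [exec_succ N ht v]
  simp only [← mem_inbox_iff N ht v]
  change nextColor a _ _ _ _ _ = _
  rw [h1, h2, h3]

variable {a β Δ} in
theorem alive_succ {t : ℕ} (ht : t < stopTime V a β Δ) (v : V) :
    (exec N a β Δ (t + 1) v).alive = true ↔ (exec N a β Δ t v).alive = true ∧
      ¬∃ u, G.Adj v u ∧ (exec N a β Δ t u).alive = true ∧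
        linialRounds (Fintype.card V) + 1 ≤ t ∧
        Beats (digitBase a β (degBound V Δ)) (t - (linialRounds (Fintype.card V) + 1))
          (exec N a β Δ t u).color (exec N a β Δ t v).color := by
  obtain ⟨h1, h2, h3⟩ := exec_parameters N ht.le v
  rw [exec_succ N ht v]
  classical
  change (_ && decide _) = true ↔ _
  rw [Bool.and_eq_true, decide_eq_true_iff, h1, h2, h3]
  simp only [mem_inbox_iff N ht v]
  refine and_congr_right fun _ => not_congr ?_
  constructor
  · rintro ⟨_, ⟨u, h4, h5, rfl⟩, h6⟩
    exact ⟨u, h4, h5, h6⟩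
  · rintro ⟨u, h4, h5, h6⟩
    exact ⟨_, ⟨u, h4, h5, rfl⟩, h6⟩

end Execution

/-! ### Correctness and running time -/

section Correctness

theorem finalScale_ne_zero (a : ℕ) {Δ : ℕ} (hΔ : Δ ≠ 0) : finalScale a Δ ≠ 0 := by
  unfold finalScale; positivity

theorem digitBase_pos (a β : ℕ) {Δ : ℕ} (hΔ : Δ ≠ 0) : 0 < digitBase a β Δ := by
  have := finalScale_ne_zero a hΔ
  unfold digitBase
  rw [Nat.ceil_pos]
  positivity

theorem le_digitBase_pow (a Δ : ℕ) {β : ℕ} (hβ : β ≠ 0) :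
    4 * finalScale a Δ ^ 2 ≤ digitBase a β Δ ^ β := by
  have h0 : (0 : ℝ) ≤ ((4 * finalScale a Δ ^ 2 : ℕ) : ℝ) := Nat.cast_nonneg _
  have h := pow_le_pow_left₀ (Real.rpow_nonneg h0 _)
    (Nat.le_ceil (((4 * finalScale a Δ ^ 2 : ℕ) : ℝ) ^ ((1 : ℝ) / β))) β
  rw [one_div, Real.rpow_inv_natCast_pow h0 hβ] at h
  rw [digitBase, one_div]
  exact_mod_cast h

theorem colorBits_pos {a n : ℕ} (ha : a ≠ 0) (hn : n ≠ 0) (Δ t : ℕ) : 0 < colorBits a n Δ t := by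
  cases t with
  | zero => exact Nat.mul_pos (Nat.pos_of_ne_zero ha) (Nat.size_pos.2 (Nat.pos_of_ne_zero hn))
  | succ t =>
    rw [colorBits, Function.iterate_succ_apply', bitsAfterStep]
    omega

theorem four_mul_sq_le_two_pow_colorBits (a n Δ t : ℕ) :
    4 * (Δ * colorBits a n Δ t) ^ 2 ≤ 2 ^ colorBits a n Δ (t + 1) := by
  rw [show colorBits a n Δ (t + 1) = bitsAfterStep Δ.size (colorBits a n Δ t) from
    Function.iterate_succ_apply' .., bitsAfterStep, mul_comm 2 (_ + _), pow_mul, pow_add,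
    pow_add]
  calc 4 * (Δ * colorBits a n Δ t) ^ 2 = (Δ * colorBits a n Δ t * 2 ^ 1) ^ 2 := by ring
    _ ≤ _ := by
      gcongr
      · exact Δ.lt_size_self.le
      · exact (Nat.lt_size_self _).le

/-- The colors after `linialRounds n` steps are few enough for the last color reduction, which uses
polynomials of degree `3`. -/
theorem two_pow_colorBits_le (a n : ℕ) {Δ : ℕ} (hΔ : Δ ≠ 0) :
    2 ^ colorBits a n Δ (linialRounds n) ≤ (finalScale a Δ + 1) ^ (3 + 1) := by
  have hs : 1 ≤ Δ.size := Nat.size_pos.2 (Nat.pos_of_ne_zero hΔ)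
  have h1 : colorBits a n Δ (3 * logStar n) ≤ (a ^ 2 + 64) * Δ :=
    (iterate_logStar_bitsAfterStep_le a n hs).trans (Nat.mul_le_mul_left _ Δ.size_le_self)
  have h2 : 2 ^ (colorBits a n Δ (3 * logStar n)).size ≤ 2 * ((a ^ 2 + 64) * Δ) :=
    (Nat.pow_le_pow_right two_pos (Nat.size_le_size h1)).trans
      (Nat.two_pow_size_le (by positivity))
  rw [linialRounds, colorBits, Function.iterate_succ_apply', bitsAfterStep, ← colorBits,
    mul_comm 2 (_ + _), pow_mul, pow_add, pow_add]
  calc (2 ^ Δ.size * 2 ^ (colorBits a n Δ (3 * logStar n)).size * 2 ^ 1) ^ 2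
      ≤ (2 * Δ * (2 * ((a ^ 2 + 64) * Δ)) * 2 ^ 1) ^ 2 := by
        gcongr
        exact Nat.two_pow_size_le hΔ
    _ ≤ (finalScale a Δ ^ 2) ^ 2 := by
        gcongr
        unfold finalScale
        nlinarith [Nat.zero_le ((a ^ 2 + 64) * Δ ^ 2), Nat.zero_le (((a ^ 2) * Δ) ^ 2),
          Nat.zero_le (a ^ 2 * Δ ^ 2)]
    _ = finalScale a Δ ^ (3 + 1) := by ring
    _ ≤ _ := by gcongr; omega

variable {V : Type*} [Fintype V] {G : SimpleGraph V} [DecidableRel G.Adj] (N : Network G)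
  {a β Δ : ℕ}

theorem degree_le_degBound (hG : G.maxDegree ≤ Δ) (v : V) : G.degree v ≤ degBound V Δ :=
  le_min ((G.degree_le_maxDegree v).trans hG) (G.degree_lt_card_verts v).le

theorem stopTime_of_ne_zero (h : degBound V Δ ≠ 0) : stopTime V a β Δ =
    linialRounds (Fintype.card V) + 1 + β * digitBase a β (degBound V Δ) := if_neg h

theorem alive_of_le (h : degBound V Δ ≠ 0) {t : ℕ}
    (ht : t ≤ linialRounds (Fintype.card V) + 1) (v : V) :
    (exec N a β Δ t v).alive = true := by
  induction t with
  | zero => rfl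
  | succ t ih =>
    refine (alive_succ N (by rw [stopTime_of_ne_zero h]; omega) v).2 ⟨ih (by omega), ?_⟩
    rintro ⟨u, -, -, h1, -⟩
    omega

theorem color_succ_of_le (h : degBound V Δ ≠ 0) {t : ℕ}
    (ht : t ≤ linialRounds (Fintype.card V)) (v : V) :
    (exec N a β Δ (t + 1) v).color =
      nextColor a (Fintype.card V) (degBound V Δ) t (exec N a β Δ t v).color
        ((fun u => (exec N a β Δ t u).color) '' G.neighborSet v) := by
  rw [color_succ N (by rw [stopTime_of_ne_zero h]; omega) v]
  congr 1
  ext c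
  simp [alive_of_le N h (show t ≤ linialRounds (Fintype.card V) + 1 by omega)]

/-- During the color reduction, the coloring is proper and has at most `2 ^ colorBits` colors. -/
theorem color_of_le (ha : a ≠ 0) (hid : ∀ v, (N.id v).size ≤ a * (Fintype.card V).size)
    (hG : G.maxDegree ≤ Δ) (h : degBound V Δ ≠ 0) {t : ℕ}
    (ht : t ≤ linialRounds (Fintype.card V)) :
    (∀ v, (exec N a β Δ t v).color < 2 ^ colorBits a (Fintype.card V) (degBound V Δ) t) ∧
      ∀ u v, G.Adj u v → (exec N a β Δ t u).color ≠ (exec N a β Δ t v).color := by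
  induction t with
  | zero =>
    exact ⟨fun v => Nat.size_le.1 (hid v), fun u v huv heq => huv.ne (N.id_injective heq)⟩
  | succ t ih =>
    obtain ⟨h1, h2⟩ := ih (by omega)
    have hL : 0 < colorBits a (Fintype.card V) (degBound V Δ) t :=
      colorBits_pos ha (fun h0 => h (by simp [degBound, h0])) _ _
    have hstep : ∀ v, (exec N a β Δ (t + 1) v).color = _ := fun v =>
      (color_succ_of_le N h (by omega) v).trans (if_pos (by omega))
    have hN : degBound V Δ * colorBits a (Fintype.card V) (degBound V Δ) t ≠ 0 :=
      Nat.mul_ne_zero h hL.ne'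
    have hm : 2 ^ colorBits a (Fintype.card V) (degBound V Δ) t ≤
        (degBound V Δ * colorBits a (Fintype.card V) (degBound V Δ) t + 1) ^
          (colorBits a (Fintype.card V) (degBound V Δ) t + 1) :=
      (Nat.pow_le_pow_right two_pos (Nat.le_succ _)).trans (Nat.pow_le_pow_left (by omega) _)
    refine ⟨fun v => ?_, fun u v huv => ?_⟩
    · rw [hstep]
      exact (colorReduction_lt hN le_rfl _ _).trans_le (four_mul_sq_le_two_pow_colorBits _ _ _ _)
    · rw [hstep, hstep]
      exact colorReduction_ne hN le_rfl (degree_le_degBound hG) (fun v => (h1 v).trans_le hm) h2 huv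

/-- The last color reduction leads to a proper coloring with `O(Δ ^ 2)` colors. -/
theorem color_final (ha : a ≠ 0) (hid : ∀ v, (N.id v).size ≤ a * (Fintype.card V).size)
    (hG : G.maxDegree ≤ Δ) (h : degBound V Δ ≠ 0) :
    (∀ v, (exec N a β Δ (linialRounds (Fintype.card V) + 1) v).color <
        4 * finalScale a (degBound V Δ) ^ 2) ∧
      ∀ u v, G.Adj u v → (exec N a β Δ (linialRounds (Fintype.card V) + 1) u).color ≠
        (exec N a β Δ (linialRounds (Fintype.card V) + 1) v).color := by
  obtain ⟨h1, h2⟩ := color_of_le (β := β) N ha hid hG h le_rfl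
  have hstep : ∀ v, (exec N a β Δ (linialRounds (Fintype.card V) + 1) v).color = _ := fun v =>
    (color_succ_of_le N h le_rfl v).trans ((if_neg (lt_irrefl _)).trans (if_pos rfl))
  have hN := finalScale_ne_zero a h
  have hd : degBound V Δ * 3 ≤ finalScale a (degBound V Δ) := by
    rw [mul_comm]
    exact Nat.mul_le_mul_right _ (by omega)
  refine ⟨fun v => ?_, fun u v huv => ?_⟩
  · rw [hstep]
    exact colorReduction_lt hN hd _ _
  · rw [hstep, hstep]
    exact colorReduction_ne hN hd (degree_le_degBound hG)
      (fun v => (h1 v).trans_le (two_pow_colorBits_le _ _ h)) h2 huv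

/-- After the color reduction, the colors stay fixed and the alive nodes are the survivors of the
elimination. -/
theorem exec_elimination (h : degBound V Δ ≠ 0) {r : ℕ}
    (hr : r ≤ β * digitBase a β (degBound V Δ)) (v : V) :
    (exec N a β Δ (linialRounds (Fintype.card V) + 1 + r) v).color =
        (exec N a β Δ (linialRounds (Fintype.card V) + 1) v).color ∧
      ((exec N a β Δ (linialRounds (Fintype.card V) + 1 + r) v).alive = true ↔
        Survives G (digitBase a β (degBound V Δ))
          (fun v => (exec N a β Δ (linialRounds (Fintype.card V) + 1) v).color) r v) := by
  induction r generalizing v with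
  | zero => exact ⟨rfl, by simp [Survives, alive_of_le N h le_rfl v]⟩
  | succ r ih =>
    have hlt : linialRounds (Fintype.card V) + 1 + r < stopTime V a β Δ := by
      rw [stopTime_of_ne_zero h]; omega
    have ih' := fun v => ih (by omega) v
    constructor
    · rw [← add_assoc, color_succ N hlt v, nextColor, if_neg (by omega), if_neg (by omega)]
      exact (ih' v).1
    · rw [← add_assoc, alive_succ N hlt v, Survives]
      simp only [(ih' _).1, (ih' _).2, Nat.add_sub_cancel_left, Nat.le_add_right, true_and]

theorem isRulingSet_outputSet (hβ : β ≠ 0) (ha : a ≠ 0)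
    (hid : ∀ v, (N.id v).size ≤ a * (Fintype.card V).size) (hG : G.maxDegree ≤ Δ) :
    IsRulingSet G 2 β ((rulingSetAlgorithm a β).outputSet N Δ (stopTime V a β Δ)) := by
  have hset : (rulingSetAlgorithm a β).outputSet N Δ (stopTime V a β Δ) =
      {v | (exec N a β Δ (stopTime V a β Δ) v).alive = true} := by
    ext v
    change _ = some true ↔ _
    rw [output_stopTime N a β Δ v, Option.some_inj]
    rfl
  rw [hset]
  by_cases h : degBound V Δ = 0
  · -- All nodes are isolated, and all of them are selected at the start.
    have hadj : ∀ u v, ¬G.Adj u v := fun u v huv => by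
      have h1 := degree_le_degBound hG u
      have h2 := (G.degree_pos_iff_exists_adj u).2 ⟨v, huv⟩
      omega
    have hzero : stopTime V a β Δ = 0 := if_pos h
    have hrs := isRulingSet_survives (G := G) (B := 1) (β := 0) (c := fun _ => 0) one_pos
      (fun u v huv => absurd huv (hadj u v)) (by simp)
    rw [hzero]
    refine ⟨fun u _ v _ => hrs.1 u trivial v trivial, fun v => ⟨v, rfl, by simp⟩⟩
  · obtain ⟨h1, h2⟩ := color_final (β := β) N ha hid hG h
    have hrs := isRulingSet_survives (digitBase_pos a β h) h2
      (fun v => (h1 v).trans_le (le_digitBase_pow a _ hβ))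
    convert hrs using 2
    ext v
    rw [stopTime_of_ne_zero h]
    exact (exec_elimination N h le_rfl v).2

theorem terminatesWithin_stopTime :
    (rulingSetAlgorithm a β).TerminatesWithin N Δ (stopTime V a β Δ) := fun v =>
  Option.isSome_iff_exists.2 ⟨_, output_stopTime N a β Δ v⟩

/-- Colors have `O(log n)` bits throughout. -/
theorem size_color_le (ha : a ≠ 0) (hid : ∀ v, (N.id v).size ≤ a * (Fintype.card V).size)
    (hG : G.maxDegree ≤ Δ) {t : ℕ} (ht : t < stopTime V a β Δ) (v : V) :
    (exec N a β Δ t v).color.size ≤ 20 * (a ^ 2 + 64) * (Fintype.card V).size := by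
  have h : degBound V Δ ≠ 0 := by
    intro h
    have : stopTime V a β Δ = 0 := if_pos h
    omega
  have hn : 1 ≤ (Fintype.card V).size :=
    Nat.size_pos.2 (Nat.pos_of_ne_zero fun h0 => h (by simp [degBound, h0]))
  have hD : (degBound V Δ).size ≤ (Fintype.card V).size := Nat.size_le_size (min_le_right _ _)
  rcases le_or_gt t (linialRounds (Fintype.card V)) with h1 | h1
  · calc (exec N a β Δ t v).color.size ≤ colorBits a (Fintype.card V) (degBound V Δ) t :=
          Nat.size_le.2 ((color_of_le N ha hid hG h h1).1 v)
      _ ≤ (a ^ 2 + 64) * (Fintype.card V).size :=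
          iterate_bitsAfterStep_le (Nat.le_add_left _ _) hD hn
            (Nat.mul_le_mul_right _ (by nlinarith)) t
      _ ≤ _ := Nat.mul_le_mul_right _ (by omega)
  · obtain ⟨r, rfl⟩ := Nat.exists_eq_add_of_le (Nat.succ_le_of_lt h1)
    rw [stopTime_of_ne_zero h] at ht
    rw [Nat.succ_eq_add_one, (exec_elimination N h (by omega) v).1]
    have h2 := ((color_final (β := β) N ha hid hG h).1 v).le
    have h3 : 4 * finalScale a (degBound V Δ) ^ 2 =
        (2 * finalScale a (degBound V Δ)) * (2 * finalScale a (degBound V Δ)) := by ring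
    have h4 : (2 * finalScale a (degBound V Δ)).size ≤
        8 * (a ^ 2 + 64) + 2 + (Fintype.card V).size := by
      refine (Nat.size_mul_le _ _).trans ?_
      have h5 : Nat.size 2 ≤ 2 := Nat.size_le.2 (by norm_num)
      have h6 : (finalScale a (degBound V Δ)).size ≤
          8 * (a ^ 2 + 64) + (Fintype.card V).size :=
        (Nat.size_mul_le _ _).trans (add_le_add (Nat.size_le_self _) hD)
      omega
    have h7 := (Nat.size_le_size (h2.trans h3.le)).trans (Nat.size_mul_le _ _)
    nlinarith

theorem messagesAtMost (ha : a ≠ 0) (hid : ∀ v, (N.id v).size ≤ a * (Fintype.card V).size)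
    (hG : G.maxDegree ≤ Δ) :
    (rulingSetAlgorithm a β).MessagesAtMost N Δ
      ((20 * (a ^ 2 + 64) + 1) * (Fintype.card V).size) := by
  intro t v p
  have hn : 1 ≤ (Fintype.card V).size := Nat.size_pos.2 (Fintype.card_pos_iff.2 ⟨v⟩)
  rw [DistributedAlgorithm.outgoing]
  split_ifs with hout
  · simp
  · have ht : t < stopTime V a β Δ := by
      by_contra! hle
      refine hout ?_
      change ((rulingSetAlgorithm a β).output (exec N a β Δ t v)).isSome
      rw [exec_of_le N hle v]
      exact terminatesWithin_stopTime N v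
    have h1 := size_color_le N ha hid hG ht v
    change ((exec N a β Δ t v).alive :: (exec N a β Δ t v).color.bits).length ≤ _
    rw [List.length_cons, Nat.size_eq_bits_len, add_mul]
    omega

theorem runTime_le {n D Δ : ℕ} (hβ : β ≠ 0) (hD : D ≤ Δ) :
    (runTime a β n D : ℝ) ≤ ((4 * finalScale a 1 ^ 2 + 6 : ℕ) : ℝ) *
      (β * (Δ : ℝ) ^ ((2 : ℝ) / β) + logStar n) := by
  rcases eq_or_ne D 0 with rfl | hD0
  · rw [runTime, if_pos rfl, Nat.cast_zero]
    positivity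
  have hβ1 : (1 : ℝ) ≤ β := by exact_mod_cast Nat.one_le_iff_ne_zero.2 hβ
  have hΔ1 : (1 : ℝ) ≤ Δ := by exact_mod_cast (show 1 ≤ Δ by omega)
  have hX : 1 ≤ (Δ : ℝ) ^ ((2 : ℝ) / β) := Real.one_le_rpow hΔ1 (by positivity)
  have hM : (1 : ℝ) ≤ ((4 * finalScale a 1 ^ 2 : ℕ) : ℝ) := by
    have := finalScale_ne_zero a one_ne_zero
    exact_mod_cast Nat.one_le_iff_ne_zero.2 (by positivity)
  -- The number of colors is `4 * finalScale a 1 ^ 2 * D ^ 2`, and the `β`-th root of its constant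
  -- factor is at most that factor itself, so the bound is uniform in `β`.
  have hroot : ((4 * finalScale a D ^ 2 : ℕ) : ℝ) ^ ((1 : ℝ) / β) ≤
      ((4 * finalScale a 1 ^ 2 : ℕ) : ℝ) * (Δ : ℝ) ^ ((2 : ℝ) / β) := by
    have hle : ((4 * finalScale a D ^ 2 : ℕ) : ℝ) ≤
        ((4 * finalScale a 1 ^ 2 : ℕ) : ℝ) * (Δ : ℝ) ^ (2 : ℝ) := by
      rw [Real.rpow_two, ← Nat.cast_pow, ← Nat.cast_mul, Nat.cast_le]
      calc 4 * finalScale a D ^ 2 = 4 * finalScale a 1 ^ 2 * D ^ 2 := by unfold finalScale; ring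
        _ ≤ _ := by gcongr
    calc _ ≤ (((4 * finalScale a 1 ^ 2 : ℕ) : ℝ) * (Δ : ℝ) ^ (2 : ℝ)) ^ ((1 : ℝ) / β) :=
          Real.rpow_le_rpow (Nat.cast_nonneg _) hle (by positivity)
      _ = ((4 * finalScale a 1 ^ 2 : ℕ) : ℝ) ^ ((1 : ℝ) / β) * (Δ : ℝ) ^ ((2 : ℝ) / β) := by
          rw [Real.mul_rpow (by positivity) (by positivity), ← Real.rpow_mul (by positivity)]
          ring_nf
      _ ≤ _ := by
          gcongr
          exact (Real.rpow_le_rpow_of_exponent_le hM (div_le_one_of_le₀ hβ1 (by positivity))).trans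
            (Real.rpow_one _).le
  have hbase : (digitBase a β D : ℝ) ≤
      (((4 * finalScale a 1 ^ 2 : ℕ) : ℝ) + 1) * (Δ : ℝ) ^ ((2 : ℝ) / β) := by
    have := (Nat.ceil_lt_add_one (Real.rpow_nonneg
      (Nat.cast_nonneg (4 * finalScale a D ^ 2)) ((1 : ℝ) / β))).le
    rw [digitBase]
    linarith
  rw [runTime, if_neg hD0, linialRounds]
  rw [Nat.cast_add (4 * finalScale a 1 ^ 2)]
  push_cast at hbase hM ⊢
  generalize (4 * (finalScale a 1 : ℝ) ^ 2) = M at *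
  generalize (Δ : ℝ) ^ ((2 : ℝ) / β) = X at *
  have h1 : (β : ℝ) * digitBase a β D ≤ β * ((M + 1) * X) := by gcongr
  have h2 : 1 ≤ (β : ℝ) * X := one_le_mul_of_one_le_of_one_le hβ1 hX
  have h3 : (0 : ℝ) ≤ logStar n := Nat.cast_nonneg _
  nlinarith [mul_nonneg (zero_le_one.trans hM) h3]

end Correctness

end rulingSetAlgorithm

/-- `Nat.size n` is the number of binary digits of `n`. -/
theorem mainTheorem4 :
    -- identifiers of `O(log n)` bits, messages of `O(log n)` bits, and a time bound with a
    -- constant that does not depend on `β`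
    ∀ a : ℕ, ∃ (κ : ℕ) (C : ℝ), ∀ β : ℕ, 2 < β →
      ∃ A : DistributedAlgorithm,
        ∀ (V : Type*) [Fintype V] (G : SimpleGraph V) [DecidableRel G.Adj] (N : Network G) (Δ : ℕ),
          (∀ v : V, (N.id v).size ≤ a * (Fintype.card V).size) →
          G.maxDegree ≤ Δ →
          A.MessagesAtMost N Δ (κ * (Fintype.card V).size) ∧
          ∃ T : ℕ,
            (T : ℝ) ≤ C * (β * (Δ : ℝ) ^ ((2 : ℝ) / β) + logStar (Fintype.card V)) ∧
            A.TerminatesWithin N Δ T ∧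
            IsRulingSet G 2 β (A.outputSet N Δ T) := by
  intro a
  refine ⟨20 * ((a + 1) ^ 2 + 64) + 1, (4 * finalScale (a + 1) 1 ^ 2 + 6 : ℕ), fun β hβ => ?_⟩
  -- Passing to `a + 1` ensures that the bound on the number of bits is positive.
  refine ⟨rulingSetAlgorithm (a + 1) β, fun V _ G _ N Δ hid hG => ?_⟩
  have hid' : ∀ v, (N.id v).size ≤ (a + 1) * (Fintype.card V).size := fun v =>
    (hid v).trans (Nat.mul_le_mul_right _ a.le_succ)
  exact ⟨rulingSetAlgorithm.messagesAtMost N a.succ_ne_zero hid' hG,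
    rulingSetAlgorithm.stopTime V (a + 1) β Δ,
    rulingSetAlgorithm.runTime_le (by omega) (min_le_left _ _),
    rulingSetAlgorithm.terminatesWithin_stopTime N,
    rulingSetAlgorithm.isRulingSet_outputSet N (by omega) a.succ_ne_zero hid' hG⟩
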